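/- Let $\Gamma$ be a metric graph, given by a finite multigraph (parallel edges and loop edges allowed) whose edges $e$ are identified with intervals of positive real lengths. Suppose that $\Gamma$ is trivalent (every vertex has valence $3$) and $3$-edge-connected (it stays connected whenever fewer than $3$ edges are deleted), and let $g$ be its first Betti number. For a divisor $D$ (a finite formal integer combination of points of $\Gamma$) let $R(D)$ be the set of continuous piecewise linear functions $\psi:\Gamma\to\mathbb R$ with integer slopes such that $\operatorname{div}(\psi)+D$ is effective, where the coefficient of $\operatorname{div}(\psi)$ at a point is minus the sum of the outgoing slopes of $\psi$ there. Let $K_\Gamma=\sum_{v}(\operatorname{val}(v)-2)\,v$ be the canonical divisor, let $2R(K_\Gamma)=\{\psi+\psi' : \psi,\psi'\in R(K_\Gamma)\}$, and let $\Gamma_\psi\subset\Gamma$ be the set of points where $\psi$ attains its minimum. A finite set $S$ of functions on $\Gamma$ is *tropically dependent* if there are real numbers $b_\psi$ $(\psi\in S)$ such that at every point $v\in\Gamma$ the minimum $\min_{\psi\in S}\{\psi(v)+b_\psi\}$ is attained by at least two elements of $S$; otherwise $S$ is *tropically independent*. A *loop* in $\Gamma$ is a nonempty connected subgraph in which every point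 has valence $2$. **Theorem.** There is a tropically independent set $S\subset 2R(K_\Gamma)$ with exactly $3g-3$ elements. Moreover, $S$ can be chosen of the form $\{\psi_{1,e}+\psi_{2,e} : e \text{ an edge of } \Gamma\}$ where, for every edge $e$, $\psi_{1,e},\psi_{2,e}\in R(K_\Gamma)$, the minimum loci $\Gamma_{\psi_{1,e}}$ and $\Gamma_{\psi_{2,e}}$ are loops, and $\Gamma_{\psi_{1,e}}\cap\Gamma_{\psi_{2,e}}$ is exactly the closed edge $e$. -/

import Mathlib

open scoped Pointwise

/-- A (model of a) metric graph: a multigraph on the vertex type `V` with edge type `E` (loops and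
parallel edges are allowed), in which every edge `e` is identified with a real interval
`[0, len e]` of positive length. The chosen orientation of the edges, from `src e` at parameter `0`
to `tgt e` at parameter `len e`, only serves to parametrize them. `V` and `E` are taken to be
finite wherever this matters. -/
structure MetricGraph (V E : Type*) where
  src : E → V
  tgt : E → V
  len : E → ℝ
  len_pos : ∀ e, 0 < len e

namespace MetricGraph

variable {V E : Type*} (Γ : MetricGraph V E)

/-- The points of the metric graph: its vertices, and the interior points of its edges. -/
inductive Point : Type _
  | vertex (v : V) : Point
  | inner (e : E) (t : Set.Ioo (0 : ℝ) (Γ.len e)) : Point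

open Classical in
/-- The parametrization of the closed edge `e` by `[0, len e]` (extended by constants to `ℝ`). -/
noncomputable def pt (e : E) (t : ℝ) : Γ.Point :=
  if h₀ : t ≤ 0 then .vertex (Γ.src e)
  else if h₁ : Γ.len e ≤ t then .vertex (Γ.tgt e)
  else .inner e ⟨t, not_le.mp h₀, not_le.mp h₁⟩

/-- The closed edge `e`, including its endpoints, as a subset of the metric graph. -/
def closedEdge (e : E) : Set Γ.Point :=
  Γ.pt e '' Set.Icc 0 (Γ.len e)

/-! ### Combinatorics of the underlying graph -/

/-- The valence of `v` in the subgraph with edge set `F`: the number of edge ends in `F` at `v`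
(an edge from `v` to `v` counts twice). -/
def valenceIn [DecidableEq V] (F : Finset E) (v : V) : ℕ :=
  (F.filter fun e => Γ.src e = v).card + (F.filter fun e => Γ.tgt e = v).card

/-- The valence of a point: the number of outgoing edge directions. -/
def valence [DecidableEq V] [Fintype E] : Γ.Point → ℕ
  | .vertex v => Γ.valenceIn Finset.univ v
  | .inner _ _ => 2

/-- Every vertex has exactly three outgoing edges. -/
def IsTrivalent [DecidableEq V] [Fintype E] : Prop :=
  ∀ v : V, Γ.valence (.vertex v) = 3

/-- The vertices `u` and `v` can be joined by a path all of whose edges lie in `F`. -/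
def Joined (F : Set E) (u v : V) : Prop :=
  Relation.EqvGen (fun a b => ∃ e ∈ F, Γ.src e = a ∧ Γ.tgt e = b) u v

/-- The spanning subgraph with edge set `F` is connected. -/
def ConnectedOn (F : Set E) : Prop :=
  Nonempty V ∧ ∀ u v : V, Γ.Joined F u v

/-- The graph stays connected whenever fewer than `k` edges are deleted. -/
def IsEdgeConnected (k : ℕ) : Prop :=
  ∀ F : Finset E, F.card < k → Γ.ConnectedOn (F : Set E)ᶜ

/-- The cellular boundary map, from 1-chains to 0-chains with rational coefficients;
`V → ℚ` is the space of 0-chains, since `V` is finite. -/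
def boundary [DecidableEq V] [Fintype E] : (E → ℚ) →ₗ[ℚ] (V → ℚ) :=
  ∑ e : E, (LinearMap.proj (R := ℚ) (φ := fun _ : E => ℚ) e).smulRight
    (Pi.single (Γ.tgt e) 1 - Pi.single (Γ.src e) 1 : V → ℚ)

/-- The genus: the first Betti number, that is, the dimension of `H₁ = ker ∂`. -/
noncomputable def genus [DecidableEq V] [Fintype E] : ℕ :=
  Module.finrank ℚ (LinearMap.ker Γ.boundary)

/-- A loop: (the point set of) a nonempty connected subgraph in which every point has
valence 2. -/
def IsLoop [DecidableEq V] (C : Set Γ.Point) : Prop :=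
  ∃ F : Finset E, F.Nonempty ∧
    (∀ e ∈ F, ∀ e' ∈ F, Γ.Joined (F : Set E) (Γ.src e) (Γ.src e')) ∧
    (∀ e ∈ F, Γ.valenceIn F (Γ.src e) = 2 ∧ Γ.valenceIn F (Γ.tgt e) = 2) ∧
    C = ⋃ e ∈ F, Γ.closedEdge e

/-! ### Piecewise linear functions and divisors -/

/-- `ψ` is continuous and piecewise linear with integer slopes: every edge has finitely many
breakpoints such that `ψ` is affine with integer slope on each closed segment of the edge with no
breakpoint in its interior. -/
def IsPL (ψ : Γ.Point → ℝ) : Prop :=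
  ∀ e : E, ∃ T : Finset ℝ, ∀ a b : ℝ, 0 ≤ a → a ≤ b → b ≤ Γ.len e →
    (∀ t ∈ T, t ∉ Set.Ioo a b) →
    ∃ m : ℤ, ∀ t ∈ Set.Icc a b, ψ (Γ.pt e t) = ψ (Γ.pt e a) + m * (t - a)

/-- The outgoing slope of `ψ` at the point with parameter `t` of the edge `e`, in the direction of
increasing parameter. -/
noncomputable def slopeForward (ψ : Γ.Point → ℝ) (e : E) (t : ℝ) : ℝ :=
  derivWithin (fun s => ψ (Γ.pt e s)) (Set.Ioi t) t

/-- The outgoing slope of `ψ` at the point with parameter `t` of the edge `e`, in the direction of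
decreasing parameter. -/
noncomputable def slopeBackward (ψ : Γ.Point → ℝ) (e : E) (t : ℝ) : ℝ :=
  -derivWithin (fun s => ψ (Γ.pt e s)) (Set.Iio t) t

/-- The coefficient of `div ψ` at a point: minus the sum of the outgoing slopes of `ψ` there. -/
noncomputable def ord [DecidableEq V] [Fintype E] (ψ : Γ.Point → ℝ) : Γ.Point → ℝ
  | .vertex v =>
      -((∑ e ∈ Finset.univ.filter (fun e => Γ.src e = v), Γ.slopeForward ψ e 0) +
        ∑ e ∈ Finset.univ.filter (fun e => Γ.tgt e = v), Γ.slopeBackward ψ e (Γ.len e))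
  | .inner e t => -(Γ.slopeForward ψ e t + Γ.slopeBackward ψ e t)

/-- A divisor: a finite formal integer combination of points. -/
abbrev Divisor := Γ.Point →₀ ℤ

theorem finite_support_valence_sub_two [DecidableEq V] [Finite V] [Fintype E] :
    (Function.support fun p : Γ.Point => (Γ.valence p : ℤ) - 2).Finite := by
  refine (Set.finite_range (Point.vertex : V → Γ.Point)).subset ?_
  rintro (v | ⟨e, t⟩) h
  · exact ⟨v, rfl⟩
  · exact absurd (by simp [valence]) h

/-- The canonical divisor: the point `p` has coefficient `valence p - 2`. -/
noncomputable def canonicalDivisor [DecidableEq V] [Finite V] [Fintype E] : Γ.Divisor :=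
  Finsupp.ofSupportFinite (fun p => (Γ.valence p : ℤ) - 2) Γ.finite_support_valence_sub_two

/-- The tropical linear series `R(D)`: the piecewise linear functions `ψ` with integer slopes such
that `div ψ + D` is effective. -/
def tropicalLinearSeries [DecidableEq V] [Fintype E] (D : Γ.Divisor) : Set (Γ.Point → ℝ) :=
  {ψ | Γ.IsPL ψ ∧ ∀ p, 0 ≤ Γ.ord ψ p + (D p : ℝ)}

/-- The locus `Γ_ψ` where `ψ` attains its global minimum. -/
def minLocus (ψ : Γ.Point → ℝ) : Set Γ.Point :=
  {p | ∀ q, ψ p ≤ ψ q}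

end MetricGraph

/-- A finite set `S` of real functions on `X` is tropically dependent if there are constants
`b ψ`, for `ψ ∈ S`, such that at every point of `X` the minimum of the numbers `ψ x + b ψ` is
attained by at least two elements of `S`. -/
def TropicallyDependent {X : Type*} (S : Finset (X → ℝ)) : Prop :=
  ∃ b : (X → ℝ) → ℝ, ∀ x : X, ∃ φ ∈ S, ∃ χ ∈ S, φ ≠ χ ∧
    (∀ ψ ∈ S, φ x + b φ ≤ ψ x + b ψ) ∧ (∀ ψ ∈ S, χ x + b χ ≤ ψ x + b ψ)

def TropicallyIndependent {X : Type*} (S : Finset (X → ℝ)) : Prop :=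
  ¬ TropicallyDependent S

/-! For each edge `e`, suppose two cycles meet exactly in the closed edge `e`. The distance
functions to the two cycles are nonnegative, and their sum vanishes exactly on `e`. At the midpoint
of `e` only the function of `e` is zero, which gives tropical independence and distinctness
(`tropicallyIndependent_of_isolated_zero`). Trivalence gives `3|V| = 2|E|`, so `|E| = 3g - 3`.

The distance to a cycle lies in `R(K)`: it is concave inside edges, and at each vertex the outgoing
slopes sum to at most 1 (`distFun_mem_tropicalLinearSeries`).

The cycles come from flows (`exists_circulations`). By 3-edge-connectivity three units flow between
the ends of `e` with unit capacities; one unit must use `e`, and the other two split into two flows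
with disjoint supports. Closing each up through `e` gives two circulations sharing only `e`, and
trivalence makes the component of `e` in each support a cycle. -/

namespace MetricGraph

variable {V E : Type*} (Γ : MetricGraph V E)

/-! ### Counting edge ends -/

section Valence

variable [DecidableEq V]

theorem valenceIn_eq_sum (F : Finset E) (w : V) :
    Γ.valenceIn F w =
      ∑ a ∈ F, ((if Γ.src a = w then 1 else 0) + (if Γ.tgt a = w then 1 else 0)) := by
  rw [valenceIn, Finset.card_filter, Finset.card_filter, Finset.sum_add_distrib]

theorem sum_valenceIn [Fintype V] (F : Finset E) : ∑ w, Γ.valenceIn F w = 2 * F.card := by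
  simp_rw [valenceIn_eq_sum]
  rw [Finset.sum_comm]
  simp [Finset.sum_add_distrib, mul_comm]

variable {Γ} in
theorem valenceIn_pos {F : Finset E} {a : E} (ha : a ∈ F) {w : V}
    (hw : Γ.src a = w ∨ Γ.tgt a = w) : 0 < Γ.valenceIn F w := by
  rw [valenceIn_eq_sum]
  refine Finset.sum_pos' (fun _ _ => Nat.zero_le _) ⟨a, ha, ?_⟩
  rcases hw with h | h <;> simp [h]

end Valence

/-! ### Integral flows, cuts, and pairs of cycles sharing one edge -/

section Flows

variable [DecidableEq V] [Fintype E]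

/-- The net inflow at the vertex `w` of the integral flow `f`. -/
def netInflow (f : E → ℤ) (w : V) : ℤ :=
  ∑ a, f a * ((if Γ.tgt a = w then 1 else 0) - (if Γ.src a = w then 1 else 0))

theorem netInflow_zero (w : V) : Γ.netInflow 0 w = 0 := by simp [netInflow]

theorem netInflow_add (f g : E → ℤ) (w : V) :
    Γ.netInflow (f + g) w = Γ.netInflow f w + Γ.netInflow g w := by
  simp [netInflow, add_mul, Finset.sum_add_distrib]

theorem netInflow_sub (f g : E → ℤ) (w : V) :
    Γ.netInflow (f - g) w = Γ.netInflow f w - Γ.netInflow g w := by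
  simp [netInflow, sub_mul, Finset.sum_sub_distrib]

theorem netInflow_single [DecidableEq E] (a : E) (n : ℤ) (w : V) :
    Γ.netInflow (Pi.single a n) w =
      n * ((if Γ.tgt a = w then 1 else 0) - (if Γ.src a = w then 1 else 0)) := by
  unfold netInflow
  rw [Finset.sum_eq_single a]
  · simp
  · intro b _ hb
    simp [Pi.single_eq_of_ne hb]
  · simp

theorem sum_netInflow (f : E → ℤ) (S : Finset V) :
    ∑ w ∈ S, Γ.netInflow f w =
      ∑ a, f a * ((if Γ.tgt a ∈ S then 1 else 0) - (if Γ.src a ∈ S then 1 else 0)) := by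
  unfold netInflow
  rw [Finset.sum_comm]
  refine Finset.sum_congr rfl fun a _ => ?_
  rw [← Finset.mul_sum, Finset.sum_sub_distrib]
  simp

/-- A unit of flow can be sent from `u` to `v` within the capacities, or a saturated cut separates
`u` from `v`. -/
theorem exists_flow_or_cut [Fintype V] (l c : E → ℤ) (hl : ∀ a, l a ≤ 0) (hc : ∀ a, 0 ≤ c a)
    (u v : V) :
    (∃ g : E → ℤ, (∀ a, l a ≤ g a ∧ g a ≤ c a) ∧
      ∀ w, Γ.netInflow g w = (if v = w then 1 else 0) - (if u = w then 1 else 0)) ∨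
    ∃ S : Finset V, u ∈ S ∧ v ∉ S ∧
      (∀ a, Γ.src a ∈ S → Γ.tgt a ∉ S → c a ≤ 0) ∧
      (∀ a, Γ.tgt a ∈ S → Γ.src a ∉ S → 0 ≤ l a) := by
  classical
  -- A maximal such `S` is the set reachable from `u`. Keeping the support of the flow inside `S`
  -- ensures that an edge leaving `S` is still unused and can be appended.
  let P : Finset V → Prop := fun S => u ∈ S ∧ ∀ x ∈ S, ∃ g : E → ℤ,
    (∀ a, l a ≤ g a ∧ g a ≤ c a) ∧ (∀ a, g a ≠ 0 → Γ.src a ∈ S ∧ Γ.tgt a ∈ S) ∧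
      ∀ w, Γ.netInflow g w = (if x = w then 1 else 0) - (if u = w then 1 else 0)
  have h0 : P {u} := by
    refine ⟨by simp, fun x hx => ⟨0, fun a => ⟨hl a, hc a⟩, by simp, fun w => ?_⟩⟩
    rw [Finset.mem_singleton.mp hx]
    simp [netInflow_zero]
  obtain ⟨S, -, ⟨hu, hS⟩, hmax⟩ := Finite.exists_le_maximal h0
  -- extending the reachable set along an edge with residual capacity
  have key : ∀ (a : E) (x y : V) (n : ℤ), x ∈ S → y ∉ S → l a ≤ n → n ≤ c a →
      (Γ.src a ∉ S ∨ Γ.tgt a ∉ S) →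
      (Γ.src a = x ∨ Γ.src a = y) → (Γ.tgt a = x ∨ Γ.tgt a = y) →
      (∀ w, Γ.netInflow (Pi.single a n) w =
        (if y = w then 1 else 0) - (if x = w then 1 else 0)) → False := by
    intro a x y n hx hy hn hn' hout hs ht hflow
    refine hy (hmax (y := insert y S) ⟨Finset.mem_insert_of_mem hu, fun z hz => ?_⟩
      (Finset.subset_insert y S) (Finset.mem_insert_self y S))
    rcases Finset.mem_insert.mp hz with rfl | hz
    · obtain ⟨g, hg1, hg2, hg3⟩ := hS x hx
      have hga : g a = 0 := by
        by_contra h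
        have := hg2 a h
        tauto
      refine ⟨g + Pi.single a n, fun b => ?_, fun b hb => ?_, fun w => ?_⟩
      · by_cases hba : b = a
        · subst hba
          simp [hga, hn, hn']
        · simpa [Pi.single_eq_of_ne hba] using hg1 b
      · by_cases hba : b = a
        · subst hba
          refine ⟨?_, ?_⟩
          · rcases hs with h | h <;> simp [h, hx]
          · rcases ht with h | h <;> simp [h, hx]
        · have := hg2 b (by simpa [Pi.single_eq_of_ne hba] using hb)
          exact ⟨Finset.mem_insert_of_mem this.1, Finset.mem_insert_of_mem this.2⟩
      · rw [netInflow_add, hg3, hflow]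
        ring
    · obtain ⟨g, hg1, hg2, hg3⟩ := hS z hz
      exact ⟨g, hg1, fun b hb => ⟨Finset.mem_insert_of_mem (hg2 b hb).1,
        Finset.mem_insert_of_mem (hg2 b hb).2⟩, hg3⟩
  by_cases hv : v ∈ S
  · obtain ⟨g, hg1, -, hg3⟩ := hS v hv
    exact Or.inl ⟨g, hg1, hg3⟩
  · refine Or.inr ⟨S, hu, hv, fun a hs ht => ?_, fun a ht hs => ?_⟩
    · by_contra! h
      exact key a _ _ 1 hs ht ((hl a).trans zero_le_one) h (Or.inr ht) (Or.inl rfl) (Or.inr rfl)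
        fun w => by rw [netInflow_single, one_mul]
    · by_contra! h
      refine key a _ _ (-1) ht hs (by omega) (by linarith [hc a]) (Or.inl hs) (Or.inr rfl)
        (Or.inl rfl) fun w => ?_
      rw [netInflow_single]
      ring

/-- The edges with exactly one endpoint in `S`. -/
def cut (S : Finset V) : Finset E :=
  Finset.univ.filter fun a => ¬ (Γ.src a ∈ S ↔ Γ.tgt a ∈ S)

theorem le_card_cut {k : ℕ} (hk : Γ.IsEdgeConnected k) {S : Finset V} {u v : V}
    (hu : u ∈ S) (hv : v ∉ S) : k ≤ (Γ.cut S).card := by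
  by_contra! h
  have hj := (hk _ h).2 u v
  have hinv : ∀ x y, Γ.Joined ((Γ.cut S : Set E)ᶜ) x y → (x ∈ S ↔ y ∈ S) := by
    intro x y hxy
    induction hxy with
    | rel x y h =>
      obtain ⟨a, ha, rfl, rfl⟩ := h
      simpa [cut] using ha
    | refl => rfl
    | symm _ _ _ ih => exact ih.symm
    | trans _ _ _ _ _ ih ih' => exact ih.trans ih'
  exact hv ((hinv u v hj).mp hu)

/-- Edge connectivity provides integral unit-capacity flows. -/
theorem exists_unit_flow [Fintype V] {k : ℕ} (hk : Γ.IsEdgeConnected k) (u v : V) (n : ℕ) (hn : n ≤ k) :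
    ∃ f : E → ℤ, (∀ a, -1 ≤ f a ∧ f a ≤ 1) ∧
      ∀ w, Γ.netInflow f w = n * ((if v = w then 1 else 0) - (if u = w then 1 else 0)) := by
  induction n with
  | zero => exact ⟨0, by simp, by simp [netInflow_zero]⟩
  | succ n ih =>
    obtain ⟨f, hf, hfw⟩ := ih (by omega)
    rcases Γ.exists_flow_or_cut (fun a => -1 - f a) (fun a => 1 - f a)
      (fun a => by linarith [hf a]) (fun a => by linarith [hf a]) u v with
      ⟨g, hg, hgw⟩ | ⟨S, hu, hv, hout, hin⟩
    · refine ⟨f + g, fun a => ?_, fun w => ?_⟩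
      · have := hg a
        simp only [Pi.add_apply]
        constructor <;> linarith
      · rw [netInflow_add, hfw, hgw]
        push_cast
        ring
    -- On a saturated cut every edge carries a full unit out of `S`, so the net outflow `n` equals
    -- the size of the cut, which is at least `k > n`.
    · exfalso
      have h1 := Γ.sum_netInflow f S
      have h2 : ∑ w ∈ S, Γ.netInflow f w = -n := by
        simp_rw [hfw]
        rw [← Finset.mul_sum, Finset.sum_sub_distrib]
        simp [hu, hv]
      have h3 : ∑ a, f a * ((if Γ.tgt a ∈ S then 1 else 0) - (if Γ.src a ∈ S then 1 else 0)) =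
          -((Γ.cut S).card : ℤ) := by
        rw [cut, Finset.card_filter]
        push_cast
        rw [← Finset.sum_neg_distrib]
        refine Finset.sum_congr rfl fun a _ => ?_
        have hfa := hf a
        by_cases hs : Γ.src a ∈ S <;> by_cases ht : Γ.tgt a ∈ S
        · simp [hs, ht]
        · have := hout a hs ht
          simp only [hs, ht, if_true, if_false, iff_false, not_true, not_false_eq_true]
          linarith
        · have := hin a ht hs
          simp only [hs, ht, if_true, if_false, false_iff, not_true, not_false_eq_true]
          linarith
        · simp [hs, ht]
      have := Γ.le_card_cut hk hu hv
      omega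

variable {Γ}

theorem IsTrivalent.valenceIn_univ (h₃ : Γ.IsTrivalent) (w : V) :
    Γ.valenceIn Finset.univ w = 3 := h₃ w

theorem IsTrivalent.three_mul_card [Fintype V] (h₃ : Γ.IsTrivalent) :
    3 * Fintype.card V = 2 * Fintype.card E := by
  have := Γ.sum_valenceIn (Finset.univ : Finset E)
  simp [h₃.valenceIn_univ] at this
  omega

/-- A loop edge takes two of the three ends at its vertex, so at most one edge would separate that
vertex from the rest; `3|V| = 2|E|` rules out a single vertex. -/
theorem IsTrivalent.src_ne_tgt [Fintype V] (h₃ : Γ.IsTrivalent) (hc : Γ.IsEdgeConnected 3)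
    (e : E) : Γ.src e ≠ Γ.tgt e := by
  classical
  intro he
  set w := Γ.src e with hw
  obtain ⟨v, hv⟩ : ∃ v, v ≠ w := by
    by_contra! h
    have : Fintype.card V = 1 := Fintype.card_eq_one_iff.mpr ⟨w, h⟩
    have := h₃.three_mul_card
    omega
  have h1 := Γ.le_card_cut hc (Finset.mem_singleton_self w) (by simpa using hv)
  have h2 := h₃.valenceIn_univ w
  have h3 : (Γ.cut {w}).card + 2 ≤ Γ.valenceIn Finset.univ w := by
    have : (2 : ℕ) = ∑ a : E, if a = e then 2 else 0 := by simp
    rw [valenceIn_eq_sum, cut, Finset.card_filter, this, ← Finset.sum_add_distrib]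
    refine Finset.sum_le_sum fun a _ => ?_
    by_cases ha : a = e
    · subst ha
      simp [← he, ← hw]
    · simp only [ha, Finset.mem_singleton]
      split_ifs <;> simp_all
  omega

/-- Every edge of a trivalent, 3-edge-connected graph is the common support of two
circulations. -/
theorem IsTrivalent.exists_circulations [Fintype V] (h₃ : Γ.IsTrivalent)
    (hc : Γ.IsEdgeConnected 3) (e : E) :
    ∃ z₁ z₂ : E → ℤ, (∀ a, -1 ≤ z₁ a ∧ z₁ a ≤ 1) ∧ (∀ a, -1 ≤ z₂ a ∧ z₂ a ≤ 1) ∧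
      (∀ w, Γ.netInflow z₁ w = 0) ∧ (∀ w, Γ.netInflow z₂ w = 0) ∧
      ∀ a, z₁ a ≠ 0 ∧ z₂ a ≠ 0 ↔ a = e := by
  classical
  have huv := h₃.src_ne_tgt hc e
  obtain ⟨f, hf, hfw⟩ := Γ.exists_unit_flow hc (Γ.src e) (Γ.tgt e) 3 le_rfl
  -- Three units leave through three edge ends of capacity 1, so each is saturated; `h3` sums the
  -- nonnegative slacks.
  have hfe : f e = 1 := by
    have h1 := hfw (Γ.src e)
    have h2 : (Γ.valenceIn Finset.univ (Γ.src e) : ℤ) = 3 := by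
      exact_mod_cast h₃.valenceIn_univ _
    rw [valenceIn_eq_sum] at h2
    push_cast at h2
    have h3 : ∑ a, ((if Γ.src a = Γ.src e then 1 - f a else 0) +
        (if Γ.tgt a = Γ.src e then 1 + f a else 0)) = 0 := by
      calc _ = Γ.netInflow f (Γ.src e) + ∑ a, ((if Γ.src a = Γ.src e then (1 : ℤ) else 0) +
            (if Γ.tgt a = Γ.src e then 1 else 0)) := by
              rw [netInflow, ← Finset.sum_add_distrib]
              refine Finset.sum_congr rfl fun a _ => ?_
              split_ifs <;> ring
        _ = 0 := by
              rw [h1, h2]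
              simp [huv.symm]
    rw [Finset.sum_eq_zero_iff_of_nonneg] at h3
    · have := h3 e (Finset.mem_univ e)
      simp only [if_true, huv.symm, if_false] at this
      linarith
    · intro a _
      have := hf a
      split_ifs <;> linarith
  have hone : ∀ w, Γ.netInflow (Pi.single e 1) w =
      (if Γ.tgt e = w then 1 else 0) - (if Γ.src e = w then 1 else 0) := fun w => by
    rw [netInflow_single, one_mul]
  set f' := f - Pi.single e 1 with hf'
  have hf'w : ∀ w, Γ.netInflow f' w =
      2 * ((if Γ.tgt e = w then 1 else 0) - (if Γ.src e = w then 1 else 0)) := fun w => by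
    rw [netInflow_sub, hfw, hone]
    push_cast
    ring
  have hf'e : f' e = 0 := by simp [hf', hfe]
  have hf'a : ∀ a, -1 ≤ f' a ∧ f' a ≤ 1 := fun a => by
    by_cases ha : a = e
    · rw [ha, hf'e]
      norm_num
    · simpa [hf', Pi.single_eq_of_ne ha] using hf a
  -- With `g` between `0` and `f'`, and `|f'| ≤ 1`, integrality makes one of `g` and `f' - g` vanish
  -- on each edge.
  rcases Γ.exists_flow_or_cut (fun a => min 0 (f' a)) (fun a => max 0 (f' a))
    (fun a => min_le_left _ _) (fun a => le_max_left _ _) (Γ.src e) (Γ.tgt e) with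
    ⟨g, hg, hgw⟩ | ⟨S, hu, hv, hout, hin⟩
  · refine ⟨g - Pi.single e 1, f' - g - Pi.single e 1, fun a => ?_, fun a => ?_, fun w => ?_,
      fun w => ?_, fun a => ?_⟩
    · have h1 := hg a
      have h2 := hf'a a
      by_cases ha : a = e
      · subst ha
        simp only [Pi.sub_apply, Pi.single_eq_same]
        omega
      · simp only [Pi.sub_apply, Pi.single_eq_of_ne ha]
        omega
    · have h1 := hg a
      have h2 := hf'a a
      by_cases ha : a = e
      · subst ha
        simp only [Pi.sub_apply, Pi.single_eq_same]
        omega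
      · simp only [Pi.sub_apply, Pi.single_eq_of_ne ha]
        omega
    · rw [netInflow_sub, hgw, hone, sub_self]
    · rw [netInflow_sub, netInflow_sub, hgw, hone, hf'w]
      ring
    · have h1 := hg a
      have h2 := hf'a a
      by_cases ha : a = e
      · subst ha
        refine iff_of_true ⟨?_, ?_⟩ rfl <;>
          simp only [Pi.sub_apply, Pi.single_eq_same] <;> omega
      · simp only [Pi.sub_apply, Pi.single_eq_of_ne ha, ha, iff_false]
        omega
  -- Across such a cut `f'` carries nothing out of `S`, yet its net inflow into `S` is `-2`.
  · exfalso
    have h1 := Γ.sum_netInflow f' S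
    have h2 : ∑ w ∈ S, Γ.netInflow f' w = -2 := by
      simp_rw [hf'w]
      rw [← Finset.mul_sum, Finset.sum_sub_distrib]
      simp [hu, hv]
    have h3 : 0 ≤ ∑ a, f' a *
        ((if Γ.tgt a ∈ S then 1 else 0) - (if Γ.src a ∈ S then 1 else 0)) := by
      refine Finset.sum_nonneg fun a _ => ?_
      by_cases hs : Γ.src a ∈ S <;> by_cases ht : Γ.tgt a ∈ S
      · simp [hs, ht]
      · have := hout a hs ht
        simpa [hs, ht] using this
      · have := hin a ht hs
        simpa [hs, ht] using this
      · simp [hs, ht]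
    omega

/-- Modulo 2 signs disappear, so the valence in the support agrees with the net inflow, which is
zero. -/
theorem even_valenceIn_support {z : E → ℤ} (hz : ∀ a, -1 ≤ z a ∧ z a ≤ 1)
    (hzw : ∀ w, Γ.netInflow z w = 0) (w : V) :
    Even (Γ.valenceIn (Finset.univ.filter fun a => z a ≠ 0) w) := by
  have h1 : (Γ.valenceIn (Finset.univ.filter fun a => z a ≠ 0) w : ℤ) =
      (Γ.valenceIn (Finset.univ.filter fun a => z a ≠ 0) w : ℤ) + Γ.netInflow z w := by
    rw [hzw, add_zero]
  rw [← Int.even_coe_nat, h1, valenceIn_eq_sum, netInflow, Finset.sum_filter]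
  push_cast
  rw [← Finset.sum_add_distrib]
  refine Finset.even_sum _ fun a _ => ?_
  have := hz a
  obtain h | h | h : z a = -1 ∨ z a = 0 ∨ z a = 1 := by omega
  all_goals
    rw [h]
    split_ifs <;> simp_all

/-- The two edge sets occupy different ends among the three at `w`. It keeps two cycles from
touching at a vertex off their common edge; `F' = ∅` gives the bound 3 for one set. -/
theorem IsTrivalent.valenceIn_add_le [DecidableEq E] (h₃ : Γ.IsTrivalent) {F F' : Finset E}
    (w : V) (hFF' : ∀ a ∈ F, a ∈ F' → Γ.src a ≠ w ∧ Γ.tgt a ≠ w) :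
    Γ.valenceIn F w + Γ.valenceIn F' w ≤ 3 := by
  have hle : ∀ F : Finset E, Γ.valenceIn F w =
      ∑ a, if a ∈ F then
        ((if Γ.src a = w then 1 else 0) + (if Γ.tgt a = w then 1 else 0)) else 0 := fun F => by
    simp [valenceIn_eq_sum]
  rw [← h₃.valenceIn_univ w, hle, hle, valenceIn_eq_sum, ← Finset.sum_add_distrib]
  refine Finset.sum_le_sum fun a _ => ?_
  have := hFF' a
  by_cases h1 : a ∈ F <;> by_cases h2 : a ∈ F' <;> simp_all

/-- The combinatorial content of `IsLoop`: a nonempty connected 2-regular edge set. -/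
structure IsCycle (Γ : MetricGraph V E) (F : Finset E) : Prop where
  nonempty : F.Nonempty
  joined : ∀ e ∈ F, ∀ e' ∈ F, Γ.Joined (F : Set E) (Γ.src e) (Γ.src e')
  valenceIn_eq : ∀ e ∈ F, Γ.valenceIn F (Γ.src e) = 2 ∧ Γ.valenceIn F (Γ.tgt e) = 2

/-- In a trivalent graph, the connected component of an edge in an even edge set is a cycle. -/
theorem IsTrivalent.exists_isCycle (h₃ : Γ.IsTrivalent) {H : Finset E}
    (hH : ∀ w, Even (Γ.valenceIn H w)) {e : E} (he : e ∈ H) :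
    ∃ F ⊆ H, e ∈ F ∧ Γ.IsCycle F := by
  classical
  set F := H.filter fun a => Γ.Joined (H : Set E) (Γ.src e) (Γ.src a) with hF
  have heF : e ∈ F := Finset.mem_filter.mpr ⟨he, Relation.EqvGen.refl _⟩
  have hedge : ∀ a ∈ H, Γ.Joined (H : Set E) (Γ.src a) (Γ.tgt a) := fun a ha =>
    Relation.EqvGen.rel _ _ ⟨a, ha, rfl, rfl⟩
  have htoF : ∀ x y, Γ.Joined (H : Set E) x y → Γ.Joined (H : Set E) (Γ.src e) x →
      Γ.Joined (F : Set E) x y := by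
    intro x y hxy
    induction hxy with
    | rel x y h =>
      obtain ⟨a, ha, rfl, rfl⟩ := h
      intro hx
      exact Relation.EqvGen.rel _ _ ⟨a, Finset.mem_coe.mpr (Finset.mem_filter.mpr ⟨ha, hx⟩),
        rfl, rfl⟩
    | refl => exact fun _ => Relation.EqvGen.refl _
    | symm x y hxy ih => exact fun hy => (ih (hy.trans _ _ _ (hxy.symm _ _))).symm _ _
    | trans x y z hxy _ ih ih' =>
      exact fun hx => (ih hx).trans _ _ _ (ih' (hx.trans _ _ _ hxy))
  have hval : ∀ w, Γ.Joined (H : Set E) (Γ.src e) w →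
      (∃ a ∈ H, Γ.src a = w ∨ Γ.tgt a = w) → Γ.valenceIn F w = 2 := by
    rintro w hw ⟨a, ha, haw⟩
    have h1 : Γ.valenceIn F w = Γ.valenceIn H w := by
      rw [valenceIn_eq_sum, valenceIn_eq_sum, hF, Finset.sum_filter]
      refine Finset.sum_congr rfl fun b hb => ?_
      by_cases hb' : Γ.Joined (H : Set E) (Γ.src e) (Γ.src b)
      · rw [if_pos hb']
      · have h1 : Γ.src b ≠ w := fun h => hb' (h ▸ hw)
        have h2 : Γ.tgt b ≠ w := fun h => hb' (hw.trans _ _ _ (h ▸ (hedge b hb).symm _ _))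
        simp [hb', h1, h2]
    -- Even, positive and at most 3 leaves only 2.
    have h2 := valenceIn_pos ha haw
    have h3 := h₃.valenceIn_add_le (F := H) (F' := ∅) w (by simp)
    obtain ⟨m, hm⟩ := hH w
    omega
  refine ⟨F, Finset.filter_subset _ _, heF, ⟨e, heF⟩, fun a ha b hb => ?_, fun a ha => ?_⟩
  · have ha' := (Finset.mem_filter.mp ha).2
    exact htoF _ _ ((ha'.symm _ _).trans _ _ _ (Finset.mem_filter.mp hb).2) ha'
  · obtain ⟨haH, ha'⟩ := Finset.mem_filter.mp ha
    exact ⟨hval _ ha' ⟨a, haH, Or.inl rfl⟩,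
      hval _ (ha'.trans _ _ _ (hedge a haH)) ⟨a, haH, Or.inr rfl⟩⟩

theorem IsTrivalent.exists_isCycle_pair [Fintype V] (h₃ : Γ.IsTrivalent)
    (hc : Γ.IsEdgeConnected 3) (e : E) :
    ∃ F₁ F₂ : Finset E, Γ.IsCycle F₁ ∧ Γ.IsCycle F₂ ∧ ∀ a, a ∈ F₁ ∧ a ∈ F₂ ↔ a = e := by
  obtain ⟨z₁, z₂, h1, h2, h3, h4, h5⟩ := h₃.exists_circulations hc e
  have he := (h5 e).mpr rfl
  obtain ⟨F₁, hF₁, he₁, hC₁⟩ := h₃.exists_isCycle (even_valenceIn_support h1 h3)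
    (Finset.mem_filter.mpr ⟨Finset.mem_univ e, he.1⟩)
  obtain ⟨F₂, hF₂, he₂, hC₂⟩ := h₃.exists_isCycle (even_valenceIn_support h2 h4)
    (Finset.mem_filter.mpr ⟨Finset.mem_univ e, he.2⟩)
  refine ⟨F₁, F₂, hC₁, hC₂, fun a => ⟨fun ha => ?_, ?_⟩⟩
  · exact (h5 a).mp ⟨(Finset.mem_filter.mp (hF₁ ha.1)).2, (Finset.mem_filter.mp (hF₂ ha.2)).2⟩
  · rintro rfl
    exact ⟨he₁, he₂⟩

end Flows

end MetricGraph

namespace MetricGraph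

variable {V E : Type*} (Γ : MetricGraph V E)

/-! ### Points and closed edges -/

section Points

@[simp]
theorem pt_zero (e : E) : Γ.pt e 0 = .vertex (Γ.src e) := by simp [pt]

@[simp]
theorem pt_len (e : E) : Γ.pt e (Γ.len e) = .vertex (Γ.tgt e) := by
  simp [pt, (Γ.len_pos e).not_ge]

theorem pt_of_mem (e : E) (t : Set.Ioo (0 : ℝ) (Γ.len e)) : Γ.pt e t = .inner e t := by
  simp [pt, t.2.1.not_ge, t.2.2.not_ge]

theorem inner_mem_closedEdge {e a : E} {t : Set.Ioo (0 : ℝ) (Γ.len e)} :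
    Point.inner e t ∈ Γ.closedEdge a ↔ e = a := by
  constructor
  · rintro ⟨s, -, hs⟩
    unfold pt at hs
    split_ifs at hs
    cases hs
    rfl
  · rintro rfl
    exact ⟨t, ⟨t.2.1.le, t.2.2.le⟩, Γ.pt_of_mem e t⟩

theorem vertex_mem_closedEdge {v : V} {a : E} :
    Point.vertex v ∈ Γ.closedEdge a ↔ Γ.src a = v ∨ Γ.tgt a = v := by
  constructor
  · rintro ⟨s, -, hs⟩
    unfold pt at hs
    split_ifs at hs <;> cases hs
    · exact Or.inl rfl
    · exact Or.inr rfl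
  · have := (Γ.len_pos a).le
    rintro (rfl | rfl)
    · exact ⟨0, ⟨le_rfl, this⟩, Γ.pt_zero a⟩
    · exact ⟨_, ⟨this, le_rfl⟩, Γ.pt_len a⟩

theorem canonicalDivisor_apply [DecidableEq V] [Finite V] [Fintype E] (p : Γ.Point) :
    Γ.canonicalDivisor p = (Γ.valence p : ℤ) - 2 := rfl

end Points

/-! ### Distance to a vertex set as an extremal potential -/

section Distance

/-- A tight potential: the distance function, on vertices, to a set of vertices `A`. -/
theorem exists_potential [Fintype V] [Fintype E]
    (hconn : ∀ u v : V, Γ.Joined Set.univ u v) {A : Set V} (hA : A.Nonempty) :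
    ∃ d : V → ℝ, (∀ v, 0 ≤ d v) ∧ (∀ v ∈ A, d v = 0) ∧
      (∀ a, |d (Γ.src a) - d (Γ.tgt a)| ≤ Γ.len a) ∧
      ∀ v ∉ A, ∃ a, (Γ.src a = v ∧ d v = d (Γ.tgt a) + Γ.len a) ∨
        (Γ.tgt a = v ∧ d v = d (Γ.src a) + Γ.len a) := by
  classical
  obtain ⟨u, hu⟩ := hA
  -- The maximizer of `∑ v, d v` on `K` is tight: a vertex off `A` with slack on all its edges could
  -- be raised. Connectedness bounds `K`, hence compactness.
  let K : Set (V → ℝ) := {d | (∀ v, 0 ≤ d v) ∧ (∀ v ∈ A, d v = 0) ∧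
    ∀ a, |d (Γ.src a) - d (Γ.tgt a)| ≤ Γ.len a}
  have hbound : ∀ x y, Γ.Joined Set.univ x y → ∃ B : ℝ, ∀ d ∈ K, |d x - d y| ≤ B := by
    intro x y hxy
    induction hxy with
    | rel x y h =>
      obtain ⟨a, -, rfl, rfl⟩ := h
      exact ⟨_, fun d hd => hd.2.2 a⟩
    | refl => exact ⟨0, fun d _ => by simp⟩
    | symm x y _ ih =>
      obtain ⟨B, hB⟩ := ih
      exact ⟨B, fun d hd => abs_sub_comm (d x) (d y) ▸ hB d hd⟩
    | trans x y z _ _ ih ih' =>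
      obtain ⟨B, hB⟩ := ih
      obtain ⟨B', hB'⟩ := ih'
      exact ⟨B + B', fun d hd =>
        (abs_sub_le _ (d y) _).trans (add_le_add (hB d hd) (hB' d hd))⟩
  choose B hB using fun v => hbound v u (hconn v u)
  have hKc : IsCompact K := by
    refine (isCompact_Icc (a := (0 : V → ℝ)) (b := B)).of_isClosed_subset ?_ fun d hd =>
      ⟨hd.1, fun v => ?_⟩
    · have h1 : IsClosed {d : V → ℝ | ∀ v, 0 ≤ d v} := by
        simp only [Set.ofPred_forall]
        exact isClosed_iInter fun v => isClosed_le continuous_const (continuous_apply v)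
      have h2 : IsClosed {d : V → ℝ | ∀ v ∈ A, d v = 0} := by
        simp only [Set.ofPred_forall]
        exact isClosed_iInter fun v => isClosed_iInter fun _ =>
          isClosed_eq (continuous_apply v) continuous_const
      have h3 : IsClosed {d : V → ℝ | ∀ a, |d (Γ.src a) - d (Γ.tgt a)| ≤ Γ.len a} := by
        simp only [Set.ofPred_forall]
        exact isClosed_iInter fun a => isClosed_le (by fun_prop) continuous_const
      exact h1.inter (h2.inter h3)
    · have := hB v d hd
      rw [hd.2.1 u hu, sub_zero] at this
      exact (le_abs_self _).trans this
  have hK0 : (0 : V → ℝ) ∈ K := ⟨fun _ => le_rfl, fun _ _ => rfl, fun a => by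
    simpa using (Γ.len_pos a).le⟩
  obtain ⟨d, hd, hmax⟩ := hKc.exists_isMaxOn ⟨0, hK0⟩
    (f := fun d : V → ℝ => ∑ v, d v) (by fun_prop)
  refine ⟨d, hd.1, hd.2.1, hd.2.2, fun v hv => ?_⟩
  by_contra! hno
  have hsrc : ∀ a, Γ.src a = v → d v < d (Γ.tgt a) + Γ.len a := fun a ha =>
    lt_of_le_of_ne (by have := abs_le.mp (hd.2.2 a); rw [← ha]; linarith) ((hno a).1 ha)
  have htgt : ∀ a, Γ.tgt a = v → d v < d (Γ.src a) + Γ.len a := fun a ha =>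
    lt_of_le_of_ne (by have := abs_le.mp (hd.2.2 a); rw [← ha]; linarith) ((hno a).2 ha)
  -- raise the value at `v` by the least slack
  obtain ⟨ε, hε, hεa⟩ : ∃ ε : ℝ, 0 < ε ∧ ∀ a,
      (Γ.src a = v → d v + ε ≤ d (Γ.tgt a) + Γ.len a) ∧
      (Γ.tgt a = v → d v + ε ≤ d (Γ.src a) + Γ.len a) := by
    have : ∀ a, ∀ᶠ ε : ℝ in nhdsWithin 0 (Set.Ioi 0),
        (Γ.src a = v → d v + ε ≤ d (Γ.tgt a) + Γ.len a) ∧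
        (Γ.tgt a = v → d v + ε ≤ d (Γ.src a) + Γ.len a) := by
      intro a
      have aux : ∀ c, d v < c → ∀ᶠ ε : ℝ in nhdsWithin 0 (Set.Ioi 0), d v + ε ≤ c := by
        intro c hc
        filter_upwards [Ioo_mem_nhdsGT (sub_pos.mpr hc)] with ε hε
        linarith [hε.2]
      refine Filter.Eventually.and ?_ ?_
      · by_cases h : Γ.src a = v
        · filter_upwards [aux _ (hsrc a h)] with ε hε _ using hε
        · exact Filter.Eventually.of_forall fun _ h' => absurd h' h
      · by_cases h : Γ.tgt a = v
        · filter_upwards [aux _ (htgt a h)] with ε hε _ using hε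
        · exact Filter.Eventually.of_forall fun _ h' => absurd h' h
    obtain ⟨ε, h1, h2⟩ := ((Filter.eventually_all.mpr this).and self_mem_nhdsWithin).exists
    exact ⟨ε, h2, h1⟩
  have hK' : Function.update d v (d v + ε) ∈ K := by
    refine ⟨fun w => ?_, fun w hw => ?_, fun a => ?_⟩
    · by_cases h : w = v
      · subst h
        have := hd.1 w
        simp
        linarith
      · simpa [h] using hd.1 w
    · have h : w ≠ v := fun h => hv (h ▸ hw)
      simpa [h] using hd.2.1 w hw
    · have h0 := abs_le.mp (hd.2.2 a)
      have h1 := (hεa a).1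
      have h2 := (hεa a).2
      have h3 := Γ.len_pos a
      rw [abs_le]
      by_cases hs : Γ.src a = v <;> by_cases ht : Γ.tgt a = v
      · rw [hs, ht]
        constructor <;> linarith
      · have := h1 hs
        rw [hs] at h0
        simp only [hs, Function.update_self, Function.update_of_ne ht]
        constructor <;> linarith
      · have := h2 ht
        rw [ht] at h0
        simp only [ht, Function.update_self, Function.update_of_ne hs]
        constructor <;> linarith
      · simpa [hs, ht] using h0
  have h1 := hmax hK'
  simp only [Set.mem_ofPred_eq] at h1
  rw [Finset.sum_update_of_mem (Finset.mem_univ v), ← Finset.add_sum_erase _ _ (Finset.mem_univ v),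
    Finset.sdiff_singleton_eq_erase] at h1
  linarith

end Distance

/-! ### One-sided slopes of a tent function -/

section Tent

/-- The function on `[0, L]` with slopes `±1` and boundary values `p`, `q`. -/
def tent (p q L t : ℝ) : ℝ := min (p + t) (q + L - t)

theorem tent_of_le {p q L t : ℝ} (h : p + t ≤ q + L - t) : tent p q L t = p + t :=
  min_eq_left h

theorem tent_of_ge {p q L t : ℝ} (h : q + L - t ≤ p + t) : tent p q L t = q + L - t :=
  min_eq_right h

theorem derivWithin_of_eqOn_affine {f : ℝ → ℝ} {m x : ℝ} {s : Set ℝ}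
    (hs : UniqueDiffWithinAt ℝ s x) (h : ∀ᶠ y in nhdsWithin x s, f y = f x + m * (y - x)) :
    derivWithin f s x = m := by
  have h1 : HasDerivWithinAt (fun y => f x + m * (y - x)) m s x := by
    simpa using ((((hasDerivAt_id x).sub_const x).const_mul m).const_add (f x)).hasDerivWithinAt
  exact (h1.congr_of_eventuallyEq h (by simp)).derivWithin hs

theorem derivWithin_Ioi_of_affine {f : ℝ → ℝ} {m x y : ℝ} (hxy : x < y)
    (h : ∀ t ∈ Set.Ioo x y, f t = f x + m * (t - x)) : derivWithin f (Set.Ioi x) x = m :=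
  derivWithin_of_eqOn_affine (uniqueDiffWithinAt_Ioi x)
    (Filter.mem_of_superset (Ioo_mem_nhdsGT hxy) h)

theorem derivWithin_Iio_of_affine {f : ℝ → ℝ} {m x y : ℝ} (hxy : y < x)
    (h : ∀ t ∈ Set.Ioo y x, f t = f x + m * (t - x)) : derivWithin f (Set.Iio x) x = m :=
  derivWithin_of_eqOn_affine (uniqueDiffWithinAt_Iio x)
    (Filter.mem_of_superset (Ioo_mem_nhdsLT hxy) h)

/-- At the apex the function already falls to the right, hence the strict inequality;
`derivWithin_Iio_tent` has `≤` because it still rises from the left. -/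
theorem derivWithin_Ioi_tent {f : ℝ → ℝ} {p q L t : ℝ} (ht : 0 ≤ t) (htL : t < L)
    (hf : ∀ s ∈ Set.Icc 0 L, f s = tent p q L s) :
    derivWithin f (Set.Ioi t) t = if p + t < q + L - t then 1 else -1 := by
  split_ifs with h
  · refine derivWithin_Ioi_of_affine (y := min L ((q + L - p) / 2))
      (lt_min htL (by linarith)) fun s hs => ?_
    have h1 := hs.2.trans_le (min_le_left _ _)
    have h2 := hs.2.trans_le (min_le_right _ _)
    rw [hf s ⟨ht.trans hs.1.le, h1.le⟩, hf t ⟨ht, htL.le⟩, tent_of_le (by linarith),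
      tent_of_le h.le]
    ring
  · push Not at h
    refine derivWithin_Ioi_of_affine htL fun s hs => ?_
    rw [hf s ⟨ht.trans hs.1.le, hs.2.le⟩, hf t ⟨ht, htL.le⟩, tent_of_ge (by linarith [hs.1]),
      tent_of_ge h]
    ring

theorem derivWithin_Iio_tent {f : ℝ → ℝ} {p q L t : ℝ} (ht : 0 < t) (htL : t ≤ L)
    (hf : ∀ s ∈ Set.Icc 0 L, f s = tent p q L s) :
    derivWithin f (Set.Iio t) t = if p + t ≤ q + L - t then 1 else -1 := by
  split_ifs with h
  · refine derivWithin_Iio_of_affine ht fun s hs => ?_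
    rw [hf s ⟨hs.1.le, hs.2.le.trans htL⟩, hf t ⟨ht.le, htL⟩, tent_of_le (by linarith [hs.2]),
      tent_of_le h]
    ring
  · push Not at h
    refine derivWithin_Iio_of_affine (y := max 0 ((q + L - p) / 2))
      (max_lt ht (by linarith)) fun s hs => ?_
    have h1 := (le_max_left _ _).trans_lt hs.1
    have h2 := (le_max_right _ _).trans_lt hs.1
    rw [hf s ⟨h1.le, hs.2.le.trans htL⟩, hf t ⟨ht.le, htL⟩, tent_of_ge (by linarith),
      tent_of_ge h.le]
    ring

end Tent

/-! ### Distance functions to cycles lie in the canonical series -/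

section DistanceFunction

/-- A distance function to a set of edges: its vertex values `d` vanish at the ends of the edges
in `F`, are 1-Lipschitz, and at every other vertex some edge leads downhill with slope 1. -/
structure IsDistance (F : Finset E) (d : V → ℝ) : Prop where
  nonneg : ∀ v, 0 ≤ d v
  eq_zero : ∀ a ∈ F, d (Γ.src a) = 0 ∧ d (Γ.tgt a) = 0
  lipschitz : ∀ a, |d (Γ.src a) - d (Γ.tgt a)| ≤ Γ.len a
  tight : ∀ v, (∃ a ∈ F, Γ.src a = v ∨ Γ.tgt a = v) ∨
    ∃ a, (Γ.src a = v ∧ d v = d (Γ.tgt a) + Γ.len a) ∨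
      (Γ.tgt a = v ∧ d v = d (Γ.src a) + Γ.len a)

theorem exists_isDistance [Fintype V] [Fintype E]
    (hconn : ∀ u v : V, Γ.Joined Set.univ u v) {F : Finset E} (hF : F.Nonempty) :
    ∃ d, Γ.IsDistance F d := by
  obtain ⟨a, ha⟩ := hF
  obtain ⟨d, h1, h2, h3, h4⟩ := Γ.exists_potential hconn
    (A := {v | ∃ a ∈ F, Γ.src a = v ∨ Γ.tgt a = v}) ⟨Γ.src a, a, ha, Or.inl rfl⟩
  exact ⟨d, h1, fun a ha => ⟨h2 _ ⟨a, ha, Or.inl rfl⟩, h2 _ ⟨a, ha, Or.inr rfl⟩⟩, h3,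
    fun v => or_iff_not_imp_left.mpr (h4 v)⟩

open Classical in
/-- The function on the metric graph that vanishes on the edges in `F` and is the distance
function with vertex values `d` elsewhere. -/
noncomputable def distFun (F : Finset E) (d : V → ℝ) : Γ.Point → ℝ
  | .vertex v => d v
  | .inner a t => if a ∈ F then 0 else tent (d (Γ.src a)) (d (Γ.tgt a)) (Γ.len a) t

variable {Γ} {F : Finset E} {d : V → ℝ}

namespace IsDistance

theorem distFun_pt_of_mem (hd : Γ.IsDistance F d) {a : E} (ha : a ∈ F) (t : ℝ) :
    Γ.distFun F d (Γ.pt a t) = 0 := by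
  unfold pt
  split_ifs
  · exact (hd.eq_zero a ha).1
  · exact (hd.eq_zero a ha).2
  · simp [distFun, ha]

theorem distFun_pt_of_notMem (hd : Γ.IsDistance F d) {a : E} (ha : a ∉ F) {t : ℝ}
    (ht : t ∈ Set.Icc 0 (Γ.len a)) :
    Γ.distFun F d (Γ.pt a t) = tent (d (Γ.src a)) (d (Γ.tgt a)) (Γ.len a) t := by
  have h := abs_le.mp (hd.lipschitz a)
  rcases ht.1.eq_or_lt with rfl | h0
  · rw [pt_zero, tent_of_le (by linarith)]
    simp [distFun]
  rcases ht.2.eq_or_lt with rfl | h1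
  · rw [pt_len, tent_of_ge (by linarith)]
    simp [distFun]
  · rw [Γ.pt_of_mem a ⟨t, h0, h1⟩]
    simp [distFun, ha]

theorem isPL (hd : Γ.IsDistance F d) : Γ.IsPL (Γ.distFun F d) := by
  intro e
  by_cases he : e ∈ F
  · exact ⟨∅, fun a b _ _ _ _ => ⟨0, fun t _ => by simp [hd.distFun_pt_of_mem he]⟩⟩
  · refine ⟨{(d (Γ.tgt e) + Γ.len e - d (Γ.src e)) / 2}, fun a b ha hab hb hT => ?_⟩
    have hx := hT _ (Finset.mem_singleton_self _)
    rw [Set.mem_Ioo, not_and_or, not_lt, not_lt] at hx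
    rcases hx with hx | hx
    · refine ⟨-1, fun t ht => ?_⟩
      rw [hd.distFun_pt_of_notMem he ⟨ha.trans ht.1, ht.2.trans hb⟩,
        hd.distFun_pt_of_notMem he ⟨ha, hab.trans hb⟩, tent_of_ge (by linarith [ht.1]),
        tent_of_ge (by linarith)]
      push_cast
      ring
    · refine ⟨1, fun t ht => ?_⟩
      rw [hd.distFun_pt_of_notMem he ⟨ha.trans ht.1, ht.2.trans hb⟩,
        hd.distFun_pt_of_notMem he ⟨ha, hab.trans hb⟩, tent_of_le (by linarith [ht.2]),
        tent_of_le (by linarith)]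
      push_cast
      ring

theorem slopeForward_of_mem (hd : Γ.IsDistance F d) {a : E} (ha : a ∈ F) (t : ℝ) :
    Γ.slopeForward (Γ.distFun F d) a t = 0 := by
  simp [slopeForward, hd.distFun_pt_of_mem ha]

theorem slopeBackward_of_mem (hd : Γ.IsDistance F d) {a : E} (ha : a ∈ F) (t : ℝ) :
    Γ.slopeBackward (Γ.distFun F d) a t = 0 := by
  simp [slopeBackward, hd.distFun_pt_of_mem ha]

theorem slopeForward_of_notMem (hd : Γ.IsDistance F d) {a : E} (ha : a ∉ F) {t : ℝ}
    (ht : 0 ≤ t) (htL : t < Γ.len a) :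
    Γ.slopeForward (Γ.distFun F d) a t =
      if d (Γ.src a) + t < d (Γ.tgt a) + Γ.len a - t then 1 else -1 :=
  derivWithin_Ioi_tent ht htL fun _ hs => hd.distFun_pt_of_notMem ha hs

theorem slopeBackward_of_notMem (hd : Γ.IsDistance F d) {a : E} (ha : a ∉ F) {t : ℝ}
    (ht : 0 < t) (htL : t ≤ Γ.len a) :
    Γ.slopeBackward (Γ.distFun F d) a t =
      -if d (Γ.src a) + t ≤ d (Γ.tgt a) + Γ.len a - t then 1 else -1 :=
  congrArg Neg.neg (derivWithin_Iio_tent ht htL fun _ hs => hd.distFun_pt_of_notMem ha hs)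

/-- A tent is concave, and on `F` the function is constant. -/
theorem ord_inner_nonneg [DecidableEq V] [Fintype E] (hd : Γ.IsDistance F d) (a : E)
    (t : Set.Ioo (0 : ℝ) (Γ.len a)) : 0 ≤ Γ.ord (Γ.distFun F d) (.inner a t) := by
  by_cases ha : a ∈ F
  · simp [ord, hd.slopeForward_of_mem ha, hd.slopeBackward_of_mem ha]
  · rw [ord, hd.slopeForward_of_notMem ha t.2.1.le t.2.2,
      hd.slopeBackward_of_notMem ha t.2.1 t.2.2.le]
    split_ifs <;> linarith

-- The slope is 0 on `F`; off `F` it is at most 1, and it drops by 2 to -1 when the whole edge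
-- descends from this end.
open Classical in
theorem slopeForward_zero_le (hd : Γ.IsDistance F d) (a : E) :
    Γ.slopeForward (Γ.distFun F d) a 0 ≤ 1 - (if a ∈ F then 1 else 0) -
      if d (Γ.src a) = d (Γ.tgt a) + Γ.len a then 2 else 0 := by
  have hl := Γ.len_pos a
  by_cases ha : a ∈ F
  · have h := hd.eq_zero a ha
    simp [hd.slopeForward_of_mem ha, ha, h.1, h.2, hl.ne]
  · rw [hd.slopeForward_of_notMem ha le_rfl hl]
    simp only [ha, if_false]
    split_ifs <;> linarith

open Classical in
theorem slopeBackward_len_le (hd : Γ.IsDistance F d) (a : E) :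
    Γ.slopeBackward (Γ.distFun F d) a (Γ.len a) ≤ 1 - (if a ∈ F then 1 else 0) -
      if d (Γ.tgt a) = d (Γ.src a) + Γ.len a then 2 else 0 := by
  have hl := Γ.len_pos a
  by_cases ha : a ∈ F
  · have h := hd.eq_zero a ha
    simp [hd.slopeBackward_of_mem ha, ha, h.1, h.2, hl.ne]
  · rw [hd.slopeBackward_of_notMem ha hl le_rfl]
    simp only [ha, if_false]
    split_ifs <;> linarith

open Classical in
theorem sum_slopes_le [DecidableEq V] [Fintype E] (hd : Γ.IsDistance F d) (v : V) :
    -Γ.ord (Γ.distFun F d) (.vertex v) ≤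
      Γ.valenceIn Finset.univ v - Γ.valenceIn F v -
        ∑ a, ((if Γ.src a = v ∧ d v = d (Γ.tgt a) + Γ.len a then (2 : ℝ) else 0) +
          if Γ.tgt a = v ∧ d v = d (Γ.src a) + Γ.len a then 2 else 0) := by
  have hF : Γ.valenceIn F v = ∑ a, if a ∈ F then
      ((if Γ.src a = v then 1 else 0) + (if Γ.tgt a = v then 1 else 0)) else 0 := by
    simp [valenceIn_eq_sum]
  rw [ord, neg_neg, hF, valenceIn_eq_sum, Finset.sum_filter, Finset.sum_filter]
  push_cast
  rw [← Finset.sum_add_distrib, ← Finset.sum_sub_distrib, ← Finset.sum_sub_distrib]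
  refine Finset.sum_le_sum fun a _ => ?_
  have h1 := hd.slopeForward_zero_le a
  have h2 := hd.slopeBackward_len_le a
  by_cases hs : Γ.src a = v <;> by_cases ht : Γ.tgt a = v
  · rw [hs, ht] at h1 h2
    simp only [hs, ht, if_true, true_and]
    split_ifs at * <;> linarith
  · rw [hs] at h1
    simp only [hs, ht, if_true, if_false, true_and, false_and]
    split_ifs at * <;> linarith
  · rw [ht] at h2
    simp only [hs, ht, if_true, if_false, true_and, false_and]
    split_ifs at * <;> linarith
  · simp [hs, ht]

/-- The outgoing slopes at a vertex must sum to at most 1. Of three edge ends, a vertex on the cycle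
has two of slope 0, and any other vertex has a descending one, replacing a 1 by -1: either way the
bound is `3 - 2`. -/
theorem distFun_mem_tropicalLinearSeries [DecidableEq V] [Fintype V] [Fintype E]
    (hd : Γ.IsDistance F d) (h₃ : Γ.IsTrivalent) (hF : Γ.IsCycle F) :
    Γ.distFun F d ∈ Γ.tropicalLinearSeries Γ.canonicalDivisor := by
  classical
  refine ⟨hd.isPL, ?_⟩
  rintro (v | ⟨a, t⟩)
  · have h1 := hd.sum_slopes_le v
    have h2 : Γ.canonicalDivisor (.vertex v) = 1 := by
      rw [canonicalDivisor_apply, h₃ v]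
      norm_num
    have h0 : ∀ a, (0 : ℝ) ≤ (if Γ.src a = v ∧ d v = d (Γ.tgt a) + Γ.len a then 2 else 0) +
        if Γ.tgt a = v ∧ d v = d (Γ.src a) + Γ.len a then 2 else 0 := fun a => by
      split_ifs <;> norm_num
    rw [h₃.valenceIn_univ] at h1
    rw [h2]
    push_cast at h1 ⊢
    rcases hd.tight v with ⟨a, ha, hav⟩ | ⟨a, hav⟩
    · have h3 : Γ.valenceIn F v = 2 := by
        rcases hav with rfl | rfl
        · exact (hF.valenceIn_eq a ha).1
        · exact (hF.valenceIn_eq a ha).2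
      have h4 := Finset.sum_nonneg fun a (_ : a ∈ Finset.univ) => h0 a
      rw [h3] at h1
      push_cast at h1
      linarith
    · have h3 := Finset.single_le_sum (fun a _ => h0 a) (Finset.mem_univ a)
      have h4 : (2 : ℝ) ≤ (if Γ.src a = v ∧ d v = d (Γ.tgt a) + Γ.len a then 2 else 0) +
          if Γ.tgt a = v ∧ d v = d (Γ.src a) + Γ.len a then 2 else 0 := by
        rcases hav with hav | hav
        · rw [if_pos hav]
          split_ifs <;> norm_num
        · rw [if_pos hav]
          split_ifs <;> norm_num
      have h5 : (0 : ℝ) ≤ Γ.valenceIn F v := Nat.cast_nonneg _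
      linarith
  · have h2 : Γ.canonicalDivisor (.inner a t) = 0 := by
      simp [canonicalDivisor_apply, valence]
    rw [h2]
    simpa using hd.ord_inner_nonneg a t

theorem distFun_nonneg (hd : Γ.IsDistance F d) (p : Γ.Point) : 0 ≤ Γ.distFun F d p := by
  rcases p with v | ⟨a, t⟩
  · exact hd.nonneg v
  · rw [distFun]
    split_ifs
    · exact le_rfl
    · exact le_min (add_nonneg (hd.nonneg _) t.2.1.le)
        (by linarith [hd.nonneg (Γ.tgt a), t.2.2])

/-- Tightness makes `d` positive at vertices off `F`, and a tent is positive inside its edge even if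
both ends lie on `F`. -/
theorem distFun_eq_zero_iff (hd : Γ.IsDistance F d) (p : Γ.Point) :
    Γ.distFun F d p = 0 ↔ p ∈ ⋃ a ∈ F, Γ.closedEdge a := by
  simp only [Set.mem_iUnion, exists_prop]
  rcases p with v | ⟨a, t⟩
  · simp only [vertex_mem_closedEdge]
    constructor
    · intro h
      rcases hd.tight v with h1 | ⟨a, ⟨rfl, h1⟩ | ⟨rfl, h1⟩⟩
      · exact h1
      · have := hd.nonneg (Γ.tgt a)
        have := Γ.len_pos a
        simp only [distFun] at h
        linarith
      · have := hd.nonneg (Γ.src a)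
        have := Γ.len_pos a
        simp only [distFun] at h
        linarith
    · rintro ⟨a, ha, rfl | rfl⟩
      · exact (hd.eq_zero a ha).1
      · exact (hd.eq_zero a ha).2
  · simp only [inner_mem_closedEdge]
    by_cases ha : a ∈ F
    · simp [distFun, ha]
    · have h : 0 < tent (d (Γ.src a)) (d (Γ.tgt a)) (Γ.len a) t :=
        lt_min (add_pos_of_nonneg_of_pos (hd.nonneg _) t.2.1)
          (by linarith [hd.nonneg (Γ.tgt a), t.2.2])
      simp [distFun, ha, h.ne']

theorem minLocus_distFun (hd : Γ.IsDistance F d) (hF : F.Nonempty) :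
    Γ.minLocus (Γ.distFun F d) = ⋃ a ∈ F, Γ.closedEdge a := by
  obtain ⟨a, ha⟩ := hF
  ext p
  rw [← hd.distFun_eq_zero_iff]
  refine ⟨fun h => le_antisymm ?_ (hd.distFun_nonneg p), fun h q => h ▸ hd.distFun_nonneg q⟩
  have := h (Γ.pt a 0)
  rwa [hd.distFun_pt_of_mem ha] at this

end IsDistance

end DistanceFunction

end MetricGraph

namespace MetricGraph

variable {V E : Type*} (Γ : MetricGraph V E)

/-! ### Genus and the Euler characteristic -/

section Genus

variable [DecidableEq V] [Fintype E]

theorem boundary_single [DecidableEq E] (a : E) :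
    Γ.boundary (Pi.single a 1) = Pi.single (Γ.tgt a) 1 - Pi.single (Γ.src a) 1 := by
  rw [boundary, LinearMap.sum_apply, Finset.sum_eq_single a]
  · simp
  · intro b _ hb
    simp [Pi.single_eq_of_ne hb]
  · simp

theorem single_sub_single_mem_range {u v : V} (h : Γ.Joined Set.univ u v) :
    (Pi.single v 1 - Pi.single u 1 : V → ℚ) ∈ LinearMap.range Γ.boundary := by
  classical
  induction h with
  | rel x y h =>
    obtain ⟨a, -, rfl, rfl⟩ := h
    exact ⟨_, Γ.boundary_single a⟩
  | refl => simp
  | symm x y _ ih => simpa using Submodule.neg_mem _ ih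
  | trans x y z _ _ ih ih' => simpa using Submodule.add_mem _ ih' ih

/-- The Euler characteristic formula for a connected graph. -/
theorem genus_add_card [Fintype V] [Nonempty V] (hconn : ∀ u v : V, Γ.Joined Set.univ u v) :
    Γ.genus + Fintype.card V = Fintype.card E + 1 := by
  classical
  let s : (V → ℚ) →ₗ[ℚ] ℚ := ∑ v, LinearMap.proj v
  have hs : ∀ x, s x = ∑ v, x v := fun x => by simp [s]
  -- Connectedness enters here: 0-chains of total zero are spanned by the differences `v - u` for a
  -- fixed `u`, each of which is a boundary.
  have hrange : LinearMap.range Γ.boundary = LinearMap.ker s := by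
    apply le_antisymm
    · rintro _ ⟨x, rfl⟩
      have hx : Γ.boundary x = ∑ a, x a •
          (Pi.single (Γ.tgt a) 1 - Pi.single (Γ.src a) 1 : V → ℚ) := by
        rw [boundary, LinearMap.sum_apply]
        rfl
      rw [LinearMap.mem_ker, hx, map_sum]
      refine Finset.sum_eq_zero fun a _ => ?_
      simp [hs, ← Finset.mul_sum]
    · intro x hx
      rw [LinearMap.mem_ker, hs] at hx
      let u := Classical.arbitrary V
      have : x = ∑ v, x v • (Pi.single v 1 - Pi.single u 1 : V → ℚ) := by
        simp_rw [smul_sub]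
        rw [Finset.sum_sub_distrib, ← Finset.sum_smul, hx, zero_smul, sub_zero]
        ext w
        simp [Finset.sum_apply, Pi.single_apply]
      rw [this]
      exact Submodule.sum_mem _ fun v _ =>
        Submodule.smul_mem _ _ (Γ.single_sub_single_mem_range (hconn u v))
  have hsurj : LinearMap.range s = ⊤ := by
    rw [LinearMap.range_eq_top]
    intro q
    exact ⟨Pi.single (Classical.arbitrary V) q, by simp [hs]⟩
  have h1 := LinearMap.finrank_range_add_finrank_ker Γ.boundary
  have h2 := LinearMap.finrank_range_add_finrank_ker s
  rw [hsurj, finrank_top, Module.finrank_self, Module.finrank_fintype_fun_eq_card] at h2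
  rw [hrange, Module.finrank_fintype_fun_eq_card] at h1
  rw [genus]
  omega

end Genus

/-! ### Edge count, intersection of cycles, independence -/

variable {Γ}

theorem IsEdgeConnected.joined_univ [DecidableEq V] [Fintype E] {k : ℕ}
    (hc : Γ.IsEdgeConnected k) (hk : 0 < k) : Γ.ConnectedOn Set.univ := by
  simpa using hc ∅ (by simpa using hk)

theorem IsTrivalent.card_eq [DecidableEq V] [Fintype V] [Fintype E] (h₃ : Γ.IsTrivalent)
    (hconn : Γ.ConnectedOn Set.univ) : (Fintype.card E : ℤ) = 3 * (Γ.genus : ℤ) - 3 := by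
  have := hconn.1
  have h1 := Γ.genus_add_card hconn.2
  have h2 := h₃.three_mul_card
  omega

theorem IsCycle.isLoop [DecidableEq V] [Fintype E] {F : Finset E} (hF : Γ.IsCycle F) :
    Γ.IsLoop (⋃ a ∈ F, Γ.closedEdge a) :=
  ⟨F, hF.nonempty, hF.joined, hF.valenceIn_eq, rfl⟩

/-- Two cycles in a trivalent graph with exactly one common edge meet in that closed edge. -/
theorem IsTrivalent.inter_cycles [DecidableEq V] [Fintype E] (h₃ : Γ.IsTrivalent)
    {F₁ F₂ : Finset E} (h₁ : Γ.IsCycle F₁) (h₂ : Γ.IsCycle F₂) {e : E}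
    (he : ∀ a, a ∈ F₁ ∧ a ∈ F₂ ↔ a = e) :
    (⋃ a ∈ F₁, Γ.closedEdge a) ∩ (⋃ a ∈ F₂, Γ.closedEdge a) = Γ.closedEdge e := by
  classical
  have he' := (he e).mpr rfl
  apply Set.Subset.antisymm
  · rintro p ⟨hp₁, hp₂⟩
    simp only [Set.mem_iUnion, exists_prop] at hp₁ hp₂
    obtain ⟨a, ha, hpa⟩ := hp₁
    obtain ⟨b, hb, hpb⟩ := hp₂
    rcases p with v | ⟨c, t⟩
    · rw [vertex_mem_closedEdge] at hpa hpb ⊢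
      -- A common vertex off `e` would need two ends for each cycle, four in all.
      by_contra hv
      have hva : Γ.valenceIn F₁ v = 2 := by
        rcases hpa with rfl | rfl
        · exact (h₁.valenceIn_eq a ha).1
        · exact (h₁.valenceIn_eq a ha).2
      have hvb : Γ.valenceIn F₂ v = 2 := by
        rcases hpb with rfl | rfl
        · exact (h₂.valenceIn_eq b hb).1
        · exact (h₂.valenceIn_eq b hb).2
      have := h₃.valenceIn_add_le (F := F₁) (F' := F₂) v fun c hc hc' => by
        rw [(he c).mp ⟨hc, hc'⟩]
        exact not_or.mp hv
      omega
    · rw [inner_mem_closedEdge] at hpa hpb ⊢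
      subst hpa hpb
      exact (he _).mp ⟨ha, hb⟩
  · intro p hp
    exact ⟨Set.mem_biUnion he'.1 hp, Set.mem_biUnion he'.2 hp⟩

end MetricGraph

/-- Functions indexed by a finite type, with values at least `0`, such that every function vanishes
at some point where all others are positive, are tropically independent. -/
theorem tropicallyIndependent_of_isolated_zero {X ι : Type*} [Nonempty ι]
    {S : Finset (X → ℝ)} {φ : ι → X → ℝ} (hS : (S : Set (X → ℝ)) = Set.range φ)
    (x : ι → X) (h0 : ∀ i, φ i (x i) = 0) (hpos : ∀ i j, i ≠ j → 0 < φ j (x i)) :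
    TropicallyIndependent S := by
  rintro ⟨b, hb⟩
  have hmem : ∀ ψ, ψ ∈ S ↔ ∃ i, φ i = ψ := fun ψ => by
    rw [← Finset.mem_coe, hS, Set.mem_range]
  -- At its isolated zero, the function with the least constant attains the minimum alone.
  obtain ⟨ψ, hψ, hmin⟩ := S.exists_min_image b
    ⟨φ (Classical.arbitrary ι), (hmem _).mpr ⟨_, rfl⟩⟩
  obtain ⟨i, rfl⟩ := (hmem ψ).mp hψ
  have huniq : ∀ χ ∈ S, (∀ ψ ∈ S, χ (x i) + b χ ≤ ψ (x i) + b ψ) → χ = φ i := by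
    intro χ hχ h
    obtain ⟨j, rfl⟩ := (hmem χ).mp hχ
    by_contra hne
    have h1 := h _ hψ
    have h2 := hpos i j fun hij => hne (hij ▸ rfl)
    have h3 := hmin _ hχ
    rw [h0] at h1
    linarith
  obtain ⟨χ, hχ, χ', hχ', hne, h1, h2⟩ := hb (x i)
  exact hne ((huniq χ hχ h1).trans (huniq χ' hχ' h2).symm)

theorem theorem1p3 {V E : Type*} [DecidableEq V] [Fintype V] [Fintype E]
    (Γ : MetricGraph V E) (h₃ : Γ.IsTrivalent) (hc : Γ.IsEdgeConnected 3) :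
    ∃ S : Finset (Γ.Point → ℝ),
      (S : Set (Γ.Point → ℝ)) ⊆ Γ.tropicalLinearSeries Γ.canonicalDivisor +
        Γ.tropicalLinearSeries Γ.canonicalDivisor ∧
      (S.card : ℤ) = 3 * (Γ.genus : ℤ) - 3 ∧
      TropicallyIndependent S ∧
      ∃ ψ₁ ψ₂ : E → Γ.Point → ℝ,
        (∀ e : E,
          ψ₁ e ∈ Γ.tropicalLinearSeries Γ.canonicalDivisor ∧
          ψ₂ e ∈ Γ.tropicalLinearSeries Γ.canonicalDivisor ∧
          Γ.IsLoop (Γ.minLocus (ψ₁ e)) ∧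
          Γ.IsLoop (Γ.minLocus (ψ₂ e)) ∧
          Γ.minLocus (ψ₁ e) ∩ Γ.minLocus (ψ₂ e) = Γ.closedEdge e) ∧
        (S : Set (Γ.Point → ℝ)) = Set.range fun e => ψ₁ e + ψ₂ e := by
  classical
  have hconn := hc.joined_univ three_pos
  choose F₁ F₂ hF₁ hF₂ he using h₃.exists_isCycle_pair hc
  choose d₁ hd₁ using fun e => Γ.exists_isDistance hconn.2 (hF₁ e).nonempty
  choose d₂ hd₂ using fun e => Γ.exists_isDistance hconn.2 (hF₂ e).nonempty
  let ψ₁ := fun e => Γ.distFun (F₁ e) (d₁ e)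
  let ψ₂ := fun e => Γ.distFun (F₂ e) (d₂ e)
  have hm₁ : ∀ e, ψ₁ e ∈ Γ.tropicalLinearSeries Γ.canonicalDivisor := fun e =>
    (hd₁ e).distFun_mem_tropicalLinearSeries h₃ (hF₁ e)
  have hm₂ : ∀ e, ψ₂ e ∈ Γ.tropicalLinearSeries Γ.canonicalDivisor := fun e =>
    (hd₂ e).distFun_mem_tropicalLinearSeries h₃ (hF₂ e)
  have hl₁ : ∀ e, Γ.minLocus (ψ₁ e) = _ := fun e => (hd₁ e).minLocus_distFun (hF₁ e).nonempty
  have hl₂ : ∀ e, Γ.minLocus (ψ₂ e) = _ := fun e => (hd₂ e).minLocus_distFun (hF₂ e).nonempty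
  have hinter := fun e => h₃.inter_cycles (hF₁ e) (hF₂ e) (he e)
  have hzero : ∀ e p, (ψ₁ e + ψ₂ e) p = 0 ↔ p ∈ Γ.closedEdge e := fun e p => by
    rw [← hinter e, Set.mem_inter_iff, ← (hd₁ e).distFun_eq_zero_iff,
      ← (hd₂ e).distFun_eq_zero_iff]
    exact add_eq_zero_iff_of_nonneg ((hd₁ e).distFun_nonneg p) ((hd₂ e).distFun_nonneg p)
  let x : E → Γ.Point := fun e =>
    .inner e ⟨Γ.len e / 2, half_pos (Γ.len_pos e), half_lt_self (Γ.len_pos e)⟩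
  have hx0 : ∀ e, (ψ₁ e + ψ₂ e) (x e) = 0 := fun e =>
    (hzero e _).mpr (Γ.inner_mem_closedEdge.mpr rfl)
  have hxpos : ∀ e e', e ≠ e' → 0 < (ψ₁ e' + ψ₂ e') (x e) := fun e e' hne =>
    lt_of_le_of_ne (add_nonneg ((hd₁ e').distFun_nonneg _) ((hd₂ e').distFun_nonneg _))
      fun h => hne (Γ.inner_mem_closedEdge.mp ((hzero e' _).mp h.symm))
  have hinj : Function.Injective fun e => ψ₁ e + ψ₂ e := fun e e' h => by
    by_contra hne
    have h1 := hxpos e e' hne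
    have h2 := hx0 e
    simp only at h
    rw [h] at h2
    exact h1.ne' h2
  have hcoe : ((Finset.univ.image fun e => ψ₁ e + ψ₂ e : Finset (Γ.Point → ℝ)) :
      Set (Γ.Point → ℝ)) = Set.range fun e => ψ₁ e + ψ₂ e := by simp
  have hE : Nonempty E := by
    have := hconn.1
    have h1 := h₃.three_mul_card
    have h2 : 0 < Fintype.card V := Fintype.card_pos
    exact Fintype.card_pos_iff.mp (by omega)
  refine ⟨Finset.univ.image fun e => ψ₁ e + ψ₂ e, ?_, ?_,
    tropicallyIndependent_of_isolated_zero hcoe x hx0 hxpos, ψ₁, ψ₂, fun e =>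
      ⟨hm₁ e, hm₂ e, hl₁ e ▸ (hF₁ e).isLoop, hl₂ e ▸ (hF₂ e).isLoop, ?_⟩, hcoe⟩
  · rw [hcoe]
    rintro _ ⟨e, rfl⟩
    exact Set.add_mem_add (hm₁ e) (hm₂ e)
  · rw [Finset.card_image_of_injective _ hinj, Finset.card_univ]
    exact h₃.card_eq hconn
  · rw [hl₁, hl₂]
    exact hinter e
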